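/- There exists an orthogonal polygon that does not admit a hidden closed mobile guard set. Here a (simple) polygon $P$ is given by a simple closed polygonal chain $\partial P$ in the plane, with vertices listed in counterclockwise order and no three consecutive vertices collinear; its interior $\mathrm{int}(P)$ is the open set enclosed by $\partial P$. The polygon $P$ is orthogonal if it can be rotated so that every edge is parallel to the $x$- or the $y$-axis. A diagonal of $P$ is a line segment $d=\overline{rs}$ between two non-consecutive vertices $r,s$ with $d\setminus\{r,s\}\subseteq\mathrm{int}(P)$. A closed mobile guard is an edge or a diagonal of $P$, including its endpoints. A guard $g$ sees a location $l$ if there is a point $p\in g$ with $\overline{lp}\setminus\{l,p\}\subseteq\mathrm{int}(P)$, and two guards $g_1,g_2$ see each other if there are points $p\in g_1$, $q\in g_2$ with $\overline{pq}\setminus\{p,q\}\subseteq\mathrm{int}(P)$. A set $S$ of closed mobile guards is a closed mobile guard set if every point of $\mathrm{int}(P)$ is seen by at least one guard in $S$, and it is hidden if no two distinct guards in $S$ see each other. -/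

import Mathlib

namespace ArtGallery

/-- The plane. (Only its affine structure, its topology and its bounded sets are used.) -/
abbrev Plane : Type := ℝ × ℝ

/-- The segment `pq` without its two endpoints, `pq - {p, q}`. It is empty when `p = q`. -/
def segmentInterior (p q : Plane) : Set Plane :=
  segment ℝ p q \ {p, q}

section

variable {n : ℕ}

/-- Twice the signed area enclosed by the closed polygonal chain `P` (the shoelace formula);
for a simple chain it is positive exactly when the vertices are listed counterclockwise. -/
def twiceSignedArea (P : Polygon Plane n) : ℝ :=
  ∑ i : Fin n,
    ((P i).1 * (P (finRotate n i)).2 - (P (finRotate n i)).1 * (P i).2)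

/-- `P` is a simple polygon with `n` vertices listed in counterclockwise order.
The edges are the closed segments `P.edgeSet ℝ i` from vertex `i` to vertex `i + 1` (cyclically). -/
structure IsSimplePolygon [NeZero n] (P : Polygon Plane n) : Prop where
  /-- no three consecutive vertices are collinear (in particular `3 ≤ n`) -/
  nondegenerate : P.HasNondegenerateVertices ℝ
  /-- consecutive edges meet only in their common vertex -/
  inter_next : ∀ i : Fin n,
    P.edgeSet ℝ i ∩ P.edgeSet ℝ (finRotate n i) = {P (finRotate n i)}
  /-- non-consecutive edges are disjoint -/
  disjoint_edges : ∀ i j : Fin n, i ≠ j → j ≠ finRotate n i → i ≠ finRotate n j →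
    Disjoint (P.edgeSet ℝ i) (P.edgeSet ℝ j)
  /-- the vertices are listed counterclockwise -/
  counterclockwise : 0 < twiceSignedArea P

/-- The interior of a polygon: the open set enclosed by its boundary, that is, the union of the
bounded connected components of the complement of the boundary. -/
def polygonInterior (P : Polygon Plane n) : Set Plane :=
  {x | x ∉ P.boundary ℝ ∧ Bornology.IsBounded (connectedComponentIn (P.boundary ℝ)ᶜ x)}

/-- `P` is orthogonal: there is an angle `θ` such that after rotating the plane by `θ`
every edge is parallel to the `y`-axis or to the `x`-axis. -/
def IsOrthogonal (P : Polygon Plane n) : Prop :=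
  ∃ θ : ℝ, ∀ i : Fin n,
    let v : Plane := P (finRotate n i) - P i
    Real.cos θ * v.1 - Real.sin θ * v.2 = 0 ∨ Real.sin θ * v.1 + Real.cos θ * v.2 = 0

/-- `g` is a closed edge of `P`. -/
def IsClosedEdge (P : Polygon Plane n) (g : Set Plane) : Prop :=
  ∃ i : Fin n, g = P.edgeSet ℝ i

/-- `g` is a closed diagonal of `P`: a segment between two non-consecutive vertices which, except
for its endpoints, lies in the interior of `P`. -/
def IsClosedDiagonal (P : Polygon Plane n) (g : Set Plane) : Prop :=
  ∃ i j : Fin n, i ≠ j ∧ j ≠ finRotate n i ∧ i ≠ finRotate n j ∧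
    segmentInterior (P i) (P j) ⊆ polygonInterior P ∧ g = segment ℝ (P i) (P j)

/-- A closed mobile guard is a closed edge or a closed diagonal. -/
def IsClosedMobileGuard (P : Polygon Plane n) (g : Set Plane) : Prop :=
  IsClosedEdge P g ∨ IsClosedDiagonal P g

/-- Two points see each other in `P` if the segment between them, without its endpoints, lies in
the interior of `P`. -/
def PointsSee (P : Polygon Plane n) (p q : Plane) : Prop :=
  segmentInterior p q ⊆ polygonInterior P

/-- The guard `g` sees the location `l` if `l` is weakly visible from `g`. -/
def GuardSees (P : Polygon Plane n) (g : Set Plane) (l : Plane) : Prop :=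
  ∃ p ∈ g, PointsSee P l p

/-- The guards `g₁` and `g₂` see each other. -/
def GuardsSeeEachOther (P : Polygon Plane n) (g₁ g₂ : Set Plane) : Prop :=
  ∃ p ∈ g₁, ∃ q ∈ g₂, PointsSee P p q

/-- `S` is a closed mobile guard set of `P`: a set of closed edges and closed diagonals such that
every location in the interior of `P` is seen by at least one guard in `S`. -/
def IsClosedMobileGuardSet (P : Polygon Plane n) (S : Set (Set Plane)) : Prop :=
  (∀ g ∈ S, IsClosedMobileGuard P g) ∧ ∀ l ∈ polygonInterior P, ∃ g ∈ S, GuardSees P g l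

/-- `S` is hidden: no two distinct guards in `S` see each other. -/
def IsHidden (P : Polygon Plane n) (S : Set (Set Plane)) : Prop :=
  S.Pairwise fun g₁ g₂ => ¬ GuardsSeeEachOther P g₁ g₂

/-- `P` admits a hidden closed mobile guard set. -/
def AdmitsHiddenClosedMobileGuardSet (P : Polygon Plane n) : Prop :=
  ∃ S : Set (Set Plane), IsClosedMobileGuardSet P S ∧ IsHidden P S

end

end ArtGallery

/-! The counterexample is the 14-gon `tower`: a wide room with a small dent at its lower left, a leg
at its lower right, and an upper room reached through a narrow neck. Three interior witness points
are chosen, one in the upper room, one in the dent and one in the leg. A guard set contains guards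
`b`, `a`, `c` seeing these three points respectively.

Every candidate `b` has one of two defects. Either it misses the dent witness but sees every guard
that could see that witness, or it misses the leg witness but sees every guard that could see that
one. In the first case `b` and `a` are distinct and see each other, in the second `b` and `c` are,
so no guard set is hidden (`tower_not_admits`).

The rest makes this finitely checkable with integers. `openSegment_subset_tower_interior` certifies
visibility, `not_guardSees_of_invisible` certifies invisibility, and
`exists_guard_of_isClosedMobileGuard` bounds the list of guards. The scaling by 12 makes both the
witnesses (quarter coordinates) and the points cutting guards into thirds integral. -/

namespace ArtGallery

/-! ### Signed areas and integer certificates for crossing and disjoint segments. -/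

/-- Twice the signed area of the triangle `p q r`. -/
def orient {R : Type*} [Mul R] [Sub R] (p q r : R × R) : R :=
  (q.1 - p.1) * (r.2 - p.2) - (q.2 - p.2) * (r.1 - p.1)

/-- The point of the plane with the given integer coordinates. -/
def latticePoint (p : ℤ × ℤ) : Plane := ((p.1 : ℝ), (p.2 : ℝ))

@[simp] lemma latticePoint_fst (p : ℤ × ℤ) : (latticePoint p).1 = p.1 := rfl

@[simp] lemma latticePoint_snd (p : ℤ × ℤ) : (latticePoint p).2 = p.2 := rfl

lemma orient_latticePoint (p q r : ℤ × ℤ) :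
    orient (latticePoint p) (latticePoint q) (latticePoint r) = (orient p q r : ℤ) := by
  simp [orient]

lemma orient_combo_right (c d a b : Plane) (t : ℝ) :
    orient c d ((1 - t) • a + t • b) = (1 - t) * orient c d a + t * orient c d b := by
  simp only [orient, Prod.fst_add, Prod.snd_add, Prod.smul_fst, Prod.smul_snd, smul_eq_mul]
  ring

lemma orient_combo_mid (w a b c : Plane) (t : ℝ) :
    orient w ((1 - t) • a + t • b) c = (1 - t) * orient w a c + t * orient w b c := by
  simp only [orient, Prod.fst_add, Prod.snd_add, Prod.smul_fst, Prod.smul_snd, smul_eq_mul]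
  ring

@[simp] lemma orient_self_left (p q : Plane) : orient p q p = 0 := by simp [orient]

@[simp] lemma orient_self_right (p q : Plane) : orient p q q = 0 := by
  simp only [orient]; ring

lemma segmentInterior_subset_openSegment (p q : Plane) :
    segmentInterior p q ⊆ openSegment ℝ p q := by
  rintro x ⟨hx, hx'⟩
  rw [← insert_endpoints_openSegment] at hx
  simp only [Set.mem_insert_iff, Set.mem_singleton_iff, not_or] at hx hx'
  tauto

lemma segmentInterior_symm (p q : Plane) : segmentInterior p q = segmentInterior q p := by
  rw [segmentInterior, segmentInterior, segment_symm, Set.pair_comm]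

/-- If the endpoints of `w p` lie strictly on different sides of the line `c d`, and `c`, `d` lie
weakly on different sides of the line `w p`, then the two segments cross. -/
lemma exists_mem_segmentInterior_mem_segment {w p c d : Plane}
    (hw : orient c d w < 0) (hp : 0 < orient c d p)
    (hc : 0 ≤ orient w p c) (hd : orient w p d ≤ 0) :
    ∃ z ∈ segmentInterior w p, z ∈ segment ℝ c d := by
  set D := orient c d p - orient c d w with hD
  have hD0 : 0 < D := by linarith
  -- This makes `D` the common denominator of the crossing point's parameters on both segments; `s`
  -- is the zero of `orient c d` along `w p`.
  have hid : orient w p c - orient w p d = D := by simp only [hD, orient]; ring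
  set s := -orient c d w / D with hs
  have hs0 : 0 < s := div_pos (by linarith) hD0
  have hs1 : s < 1 := by rw [hs, div_lt_one hD0]; linarith
  have hz : orient c d ((1 - s) • w + s • p) = 0 := by
    rw [orient_combo_right, hs]; field_simp; ring
  refine ⟨(1 - s) • w + s • p, ⟨?_, ?_⟩, ?_⟩
  · rw [segment_eq_image]; exact ⟨s, ⟨hs0.le, hs1.le⟩, rfl⟩
  · rintro (h | h)
    · rw [h] at hz; linarith
    · rw [Set.mem_singleton_iff] at h; rw [h] at hz; linarith
  · rw [segment_eq_image]
    refine ⟨orient w p c / D, ⟨div_nonneg hc hD0.le, ?_⟩, ?_⟩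
    · rw [div_le_one hD0]; linarith
    · simp only [hs]
      have hD' : D ≠ 0 := hD0.ne'
      ext
      · simp only [Prod.fst_add, Prod.smul_fst, smul_eq_mul]
        field_simp
        simp only [hD, orient]; ring
      · simp only [Prod.snd_add, Prod.smul_snd, smul_eq_mul]
        field_simp
        simp only [hD, orient]; ring

/-- The values `c`, `d` are at most, and on average of `a` and `b` less than, `a` and `b`. -/
def dominates (a b c d : ℤ) : Bool :=
  decide (c ≤ a) && decide (c ≤ b) && decide (d ≤ a) && decide (d ≤ b) &&
    decide (2 * c < a + b) && decide (2 * d < a + b)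

lemma combo_lt_combo_of_dominates {a b c d : ℤ} (h : dominates a b c d = true) {s t u v : ℝ}
    (hs : 0 < s) (ht : 0 < t) (hst : s + t = 1) (hu : 0 ≤ u) (hv : 0 ≤ v) (huv : u + v = 1) :
    u * c + v * d < s * a + t * b := by
  simp only [dominates, Bool.and_eq_true, decide_eq_true_eq] at h
  obtain ⟨⟨⟨⟨⟨h1, h2⟩, h3⟩, h4⟩, h5⟩, h6⟩ := h
  have key : ∀ m : ℤ, m ≤ a → m ≤ b → 2 * m < a + b → (m : ℝ) < s * a + t * b := by
    intro m ha hb hab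
    have ha' : (m : ℝ) ≤ a := mod_cast ha
    have hb' : (m : ℝ) ≤ b := mod_cast hb
    have hm : (m : ℝ) = s * m + t * m := by rw [← add_mul, hst, one_mul]
    have h : m < a ∨ m < b := by omega
    rcases h with h | h
    · have h' : (m : ℝ) < a := mod_cast h
      nlinarith [mul_pos hs (sub_pos.2 h'), mul_nonneg ht.le (sub_nonneg.2 hb')]
    · have h' : (m : ℝ) < b := mod_cast h
      nlinarith [mul_pos ht (sub_pos.2 h'), mul_nonneg hs.le (sub_nonneg.2 ha')]
  have hc := key c h1 h2 h5
  have hd := key d h3 h4 h6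
  generalize s * (a : ℝ) + t * b = M at hc hd ⊢
  have hM : M = u * M + v * M := by rw [← add_mul, huv, one_mul]
  rcases hu.eq_or_lt with rfl | hu'
  · obtain rfl : v = 1 := by linarith
    linarith
  · nlinarith [mul_lt_mul_of_pos_left hc hu', mul_le_mul_of_nonneg_left hd.le hv]

/-- A coordinate function or the line `p q` itself separates the open segment `p q` from the closed
segment `c d`. -/
def separated (p q c d : ℤ × ℤ) : Bool :=
  dominates p.1 q.1 c.1 d.1 || dominates (-p.1) (-q.1) (-c.1) (-d.1) ||
  dominates p.2 q.2 c.2 d.2 || dominates (-p.2) (-q.2) (-c.2) (-d.2) ||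
  dominates 0 0 (orient p q c) (orient p q d) || dominates 0 0 (-orient p q c) (-orient p q d)

lemma disjoint_of_separated {p q c d : ℤ × ℤ} (h : separated p q c d = true) :
    Disjoint (openSegment ℝ (latticePoint p) (latticePoint q))
      (segment ℝ (latticePoint c) (latticePoint d)) := by
  rw [Set.disjoint_left]
  rintro z ⟨s, t, hs, ht, hst, rfl⟩ ⟨u, v, hu, hv, huv, hz⟩
  have hx := congrArg Prod.fst hz
  have hy := congrArg Prod.snd hz
  simp only [Prod.fst_add, Prod.snd_add, Prod.smul_fst, Prod.smul_snd, smul_eq_mul,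
    latticePoint_fst, latticePoint_snd] at hx hy
  -- `orient p q` vanishes on the line `p q`, in particular at the supposed common point; this
  -- refutes the last two alternatives of `separated`.
  have ho : u * ((orient p q c : ℤ) : ℝ) + v * ((orient p q d : ℤ) : ℝ) = 0 := by
    obtain rfl : s = 1 - t := by linarith
    obtain rfl : u = 1 - v := by linarith
    rw [← orient_latticePoint, ← orient_latticePoint, ← orient_combo_right, hz,
      orient_combo_right]
    simp
  simp only [separated, Bool.or_eq_true] at h
  rcases h with ((((h | h) | h) | h) | h) | h <;>
    have := combo_lt_combo_of_dominates h hs ht hst hu hv huv <;> push_cast at this <;> linarith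

/-- The segment `c d` crosses the line from `w` to the point `(1 - k / 12) a + (k / 12) b`. -/
def blocksAt (w a b c d : ℤ × ℤ) (k : ℤ) : Bool :=
  decide (orient c d w < 0) &&
  decide (0 < (12 - k) * orient c d a + k * orient c d b) &&
  decide (0 ≤ (12 - k) * orient w a c + k * orient w b c) &&
  decide ((12 - k) * orient w a d + k * orient w b d ≤ 0)

/-- An affine function keeps its sign between two parameters, so testing `blocksAt` at both ends of
a parameter interval settles the whole interval. -/
lemma affine_nonneg {α β t₀ t₁ t : ℝ} (h₀ : 0 ≤ (12 - t₀) * α + t₀ * β)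
    (h₁ : 0 ≤ (12 - t₁) * α + t₁ * β) (ht₀ : t₀ ≤ 12 * t) (ht₁ : 12 * t ≤ t₁) :
    0 ≤ (1 - t) * α + t * β := by
  rcases le_total α β with h | h <;> nlinarith

lemma affine_pos {α β t₀ t₁ t : ℝ} (h₀ : 0 < (12 - t₀) * α + t₀ * β)
    (h₁ : 0 < (12 - t₁) * α + t₁ * β) (ht₀ : t₀ ≤ 12 * t) (ht₁ : 12 * t ≤ t₁) :
    0 < (1 - t) * α + t * β := by
  rcases le_total α β with h | h <;> nlinarith

lemma exists_mem_of_blocksAt {w a b c d : ℤ × ℤ} {k₀ k₁ : ℤ}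
    (h₀ : blocksAt w a b c d k₀ = true) (h₁ : blocksAt w a b c d k₁ = true) {t : ℝ}
    (ht₀ : k₀ ≤ 12 * t) (ht₁ : 12 * t ≤ k₁) :
    ∃ z ∈ segmentInterior (latticePoint w) ((1 - t) • latticePoint a + t • latticePoint b),
      z ∈ segment ℝ (latticePoint c) (latticePoint d) := by
  simp only [blocksAt, Bool.and_eq_true, decide_eq_true_eq] at h₀ h₁
  obtain ⟨⟨⟨hw, hp₀⟩, hc₀⟩, hd₀⟩ := h₀
  obtain ⟨⟨⟨-, hp₁⟩, hc₁⟩, hd₁⟩ := h₁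
  apply exists_mem_segmentInterior_mem_segment
  · rw [orient_latticePoint]; exact_mod_cast hw
  · rw [orient_combo_right, orient_latticePoint, orient_latticePoint]
    exact affine_pos (by exact_mod_cast hp₀) (by exact_mod_cast hp₁) ht₀ ht₁
  · rw [orient_combo_mid, orient_latticePoint, orient_latticePoint]
    exact affine_nonneg (by exact_mod_cast hc₀) (by exact_mod_cast hc₁) ht₀ ht₁
  · rw [orient_combo_mid, orient_latticePoint, orient_latticePoint]
    have hd₀' : ((12 - k₀) * orient w a d + k₀ * orient w b d : ℝ) ≤ 0 := by exact_mod_cast hd₀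
    have hd₁' : ((12 - k₁) * orient w a d + k₁ * orient w b d : ℝ) ≤ 0 := by exact_mod_cast hd₁
    have := affine_nonneg (α := -(orient w a d : ℤ)) (β := -(orient w b d : ℤ))
      (by linarith) (by linarith) ht₀ ht₁
    linarith

/-- Affine independence of a triangle from its signed area. -/
lemma affineIndependent_of_orient_ne_zero {p q r : Plane} (h : orient p q r ≠ 0) :
    AffineIndependent ℝ ![p, q, r] := by
  rw [affineIndependent_iff_not_collinear_set]
  intro hc
  rw [collinear_iff_of_mem (p₀ := p) (by simp)] at hc
  obtain ⟨v, hv⟩ := hc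
  obtain ⟨s, hs⟩ := hv q (by simp)
  obtain ⟨t, ht⟩ := hv r (by simp)
  apply h
  rw [hs, ht]
  simp only [orient, vadd_eq_add, Prod.fst_add, Prod.snd_add, Prod.smul_fst, Prod.smul_snd,
    smul_eq_mul]
  ring

lemma segment_inter_segment_of_orient_ne_zero {a b c : Plane} (h : orient b c a ≠ 0) :
    segment ℝ a b ∩ segment ℝ b c = {b} := by
  ext z
  simp only [Set.mem_inter_iff, Set.mem_singleton_iff]
  constructor
  · rintro ⟨h₁, h₂⟩
    rw [segment_symm, segment_eq_image] at h₁
    rw [segment_eq_image] at h₂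
    obtain ⟨s, -, rfl⟩ := h₁
    obtain ⟨t, -, ht⟩ := h₂
    -- `orient b c` is zero on the second segment and `s * orient b c a` on the first.
    have := congrArg (orient b c) ht
    simp only [orient_combo_right, orient_self_left, orient_self_right] at this
    have hs : s = 0 := by
      simpa [h] using this
    simp [hs]
  · rintro rfl
    exact ⟨right_mem_segment _ _ _, left_mem_segment _ _ _⟩

/-! ### The counterexample polygon. -/

/-- The vertices of the polygon, divided by `12`. -/
def corner : Fin 14 → ℤ × ℤ :=
  ![(0, 4), (1, 4), (1, 5), (7, 5), (7, 0), (13, 0), (13, 10), (5, 10), (5, 11), (8, 11), (8, 18),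
    (3, 18), (3, 10), (0, 10)]

/-- The integer coordinates of the vertices of the polygon. -/
def vertex (i : Fin 14) : ℤ × ℤ := (12 * (corner i).1, 12 * (corner i).2)

/-- An orthogonal polygon without a hidden closed mobile guard set: a wide room with a dent and a
leg below it, and a second room above it that is reached through a neck. -/
def tower : Polygon Plane 14 := ⟨fun i => latticePoint (vertex i)⟩

lemma tower_apply (i : Fin 14) : tower i = latticePoint (vertex i) := rfl

lemma tower_edgeSet (i : Fin 14) : tower.edgeSet ℝ i =
    segment ℝ (latticePoint (vertex i)) (latticePoint (vertex (i + 1))) := by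
  rw [Polygon.edgeSet, affineSegment_eq_segment, finRotate_apply]; rfl

lemma mem_tower_boundary {x : Plane} : x ∈ tower.boundary ℝ ↔
    ∃ i, x ∈ segment ℝ (latticePoint (vertex i)) (latticePoint (vertex (i + 1))) := by
  simp only [Polygon.boundary, Set.mem_iUnion, tower_edgeSet]

/-! ### The polygon is simple and orthogonal -/

lemma tower_orthogonal : IsOrthogonal tower := by
  have h : ∀ i : Fin 14, (vertex (i + 1)).1 = (vertex i).1 ∨ (vertex (i + 1)).2 = (vertex i).2 := by
    decide
  refine ⟨0, fun i => ?_⟩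
  simp only [Real.cos_zero, Real.sin_zero, one_mul, zero_mul, sub_zero, zero_add, finRotate_apply,
    tower_apply, Prod.fst_sub, Prod.snd_sub, latticePoint_fst, latticePoint_snd, sub_eq_zero,
    Int.cast_inj]
  exact h i

lemma disjoint_segment_of_lt {c d c' d' : ℤ × ℤ}
    (h : (max c.1 d.1 < min c'.1 d'.1 ∨ max c'.1 d'.1 < min c.1 d.1) ∨
      max c.2 d.2 < min c'.2 d'.2 ∨ max c'.2 d'.2 < min c.2 d.2) :
    Disjoint (segment ℝ (latticePoint c) (latticePoint d))
      (segment ℝ (latticePoint c') (latticePoint d')) := by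
  rw [Set.disjoint_left]
  intro z hz hz'
  have hfst : ∀ a b : ℤ × ℤ, z ∈ segment ℝ (latticePoint a) (latticePoint b) →
      ((min a.1 b.1 : ℤ) : ℝ) ≤ z.1 ∧ z.1 ≤ ((max a.1 b.1 : ℤ) : ℝ) ∧
      ((min a.2 b.2 : ℤ) : ℝ) ≤ z.2 ∧ z.2 ≤ ((max a.2 b.2 : ℤ) : ℝ) := by
    intro a b hab
    have h₁ := Prod.segment_subset _ _ hab
    simp only [segment_eq_uIcc, Set.mem_prod, Set.uIcc, Set.mem_Icc, latticePoint_fst,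
      latticePoint_snd] at h₁
    push_cast
    exact ⟨h₁.1.1, h₁.1.2, h₁.2.1, h₁.2.2⟩
  obtain ⟨h₁, h₂, h₃, h₄⟩ := hfst _ _ hz
  obtain ⟨h₁', h₂', h₃', h₄'⟩ := hfst _ _ hz'
  rcases h with (h | h) | (h | h) <;>
    (have h' := (Int.cast_lt (R := ℝ)).2 h; linarith)

lemma tower_simple : IsSimplePolygon tower where
  nondegenerate i := by
    have h : ∀ i : Fin 14, orient (vertex i) (vertex (i + 1)) (vertex (i + 2)) ≠ 0 := by decide
    apply affineIndependent_of_orient_ne_zero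
    rw [tower_apply, tower_apply, tower_apply, orient_latticePoint]
    exact_mod_cast h i
  inter_next i := by
    have h : ∀ i : Fin 14, orient (vertex (i + 1)) (vertex (i + 1 + 1)) (vertex i) ≠ 0 := by decide
    rw [tower_edgeSet, tower_edgeSet, finRotate_apply, tower_apply]
    apply segment_inter_segment_of_orient_ne_zero
    rw [orient_latticePoint]
    exact_mod_cast h i
  disjoint_edges i j hij hj hi := by
    rw [finRotate_apply] at hj hi
    rw [tower_edgeSet, tower_edgeSet]
    apply disjoint_segment_of_lt
    revert i j
    decide +kernel
  counterclockwise := by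
    have h : (0 : ℤ) < ∑ i : Fin 14, ((vertex i).1 * (vertex (i + 1)).2 -
        (vertex (i + 1)).1 * (vertex i).2) := by decide
    simp only [twiceSignedArea, finRotate_apply, tower_apply, latticePoint_fst, latticePoint_snd]
    exact_mod_cast h

/-! ### The interior of the polygon -/

/-- The maximal rectangles in the polygon, as `(left, right, bottom, top)`, divided by `12`. -/
def rooms : List (ℤ × ℤ × ℤ × ℤ) :=
  [(0, 1, 4, 10), (0, 13, 5, 10), (7, 13, 0, 10), (3, 5, 5, 18), (3, 8, 11, 18)]

/-- The interior of a rectangle given by integers. -/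
def openRoom (r : ℤ × ℤ × ℤ × ℤ) : Set Plane :=
  Set.Ioo (12 * r.1 : ℝ) (12 * r.2.1) ×ˢ Set.Ioo (12 * r.2.2.1 : ℝ) (12 * r.2.2.2)

/-- A closed rectangle given by integers. -/
def closedRoom (r : ℤ × ℤ × ℤ × ℤ) : Set Plane :=
  Set.Icc (12 * r.1 : ℝ) (12 * r.2.1) ×ˢ Set.Icc (12 * r.2.2.1 : ℝ) (12 * r.2.2.2)

/-- The position of a real number among the integer multiples of `12`. -/
noncomputable def gridIndex (x : ℝ) : ℤ := ⌊x / 12⌋ + ⌈x / 12⌉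

/-- The index is `2 * c` at `12 * c` and `2 * c + 1` strictly between `12 * c` and `12 * (c + 1)`,
so it records every comparison with multiples of 12. -/
lemma gridIndex_lt {x : ℝ} {c : ℤ} : gridIndex x < 2 * c ↔ x < 12 * c := by
  have h : x < 12 * c ↔ x / 12 < c := by rw [div_lt_iff₀' (by norm_num)]
  rw [h, gridIndex]
  constructor
  · intro hlt
    by_contra! hle
    have h₁ := Int.le_floor.2 hle
    have h₂ := h₁.trans (Int.floor_le_ceil (x / 12))
    omega
  · intro hlt
    have h₁ := Int.floor_lt.2 hlt
    have h₂ := Int.ceil_le.2 hlt.le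
    omega

lemma lt_gridIndex {x : ℝ} {c : ℤ} : 2 * c < gridIndex x ↔ 12 * c < x := by
  have h : 12 * c < x ↔ c < x / 12 := by rw [lt_div_iff₀' (by norm_num)]
  rw [h, gridIndex]
  constructor
  · intro hlt
    by_contra! hle
    have h₁ := Int.ceil_le.2 hle
    have h₂ := (Int.floor_le_ceil (x / 12)).trans h₁
    omega
  · intro hlt
    have h₁ := Int.lt_ceil.2 hlt
    have h₂ := Int.le_floor.2 hlt.le
    omega

lemma gridIndex_le {x : ℝ} {c : ℤ} : gridIndex x ≤ 2 * c ↔ x ≤ 12 * c := by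
  rw [← not_lt, ← not_lt, lt_gridIndex]

lemma le_gridIndex {x : ℝ} {c : ℤ} : 2 * c ≤ gridIndex x ↔ 12 * c ≤ x := by
  rw [← not_lt, ← not_lt, gridIndex_lt]

lemma mem_segment_of_box {c d : ℤ × ℤ} {x : Plane} (hcd : d.1 = c.1 ∨ d.2 = c.2)
    (h₁ : min c.1 d.1 ≤ x.1) (h₂ : x.1 ≤ max c.1 d.1)
    (h₃ : min c.2 d.2 ≤ x.2) (h₄ : x.2 ≤ max c.2 d.2) :
    x ∈ segment ℝ (latticePoint c) (latticePoint d) := by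
  obtain ⟨x₁, x₂⟩ := x
  obtain ⟨c₁, c₂⟩ := c
  obtain ⟨d₁, d₂⟩ := d
  dsimp only at *
  rcases hcd with rfl | rfl
  · obtain rfl : x₁ = d₁ := le_antisymm (by simpa using h₂) (by simpa using h₁)
    rw [latticePoint, latticePoint, ← Prod.image_mk_segment_right, segment_eq_uIcc]
    exact ⟨x₂, ⟨by exact_mod_cast h₃, by exact_mod_cast h₄⟩, rfl⟩
  · obtain rfl : x₂ = d₂ := le_antisymm (by simpa using h₄) (by simpa using h₃)
    rw [latticePoint, latticePoint, ← Prod.image_mk_segment_left, segment_eq_uIcc]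
    exact ⟨x₁, ⟨by exact_mod_cast h₁, by exact_mod_cast h₂⟩, rfl⟩

/-- All rooms and edges are bounded by multiples of 12, so membership depends only on the two grid
indices. These range over `0, ..., 2 * 13` and `0, ..., 2 * 18`, which leaves a finite check. -/
lemma closedRoom_subset {r : ℤ × ℤ × ℤ × ℤ} (hr : r ∈ rooms) {x : Plane} (hx : x ∈ closedRoom r) :
    (∃ r ∈ rooms, x ∈ openRoom r) ∨ x ∈ tower.boundary ℝ := by
  have key : ∀ i : Fin 27, ∀ j : Fin 37,
      (∃ r ∈ rooms, (2 * r.1 ≤ (i : ℕ) ∧ (i : ℕ) ≤ 2 * r.2.1) ∧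
        2 * r.2.2.1 ≤ (j : ℕ) ∧ (j : ℕ) ≤ 2 * r.2.2.2) →
      (∃ r ∈ rooms, (2 * r.1 < (i : ℕ) ∧ (i : ℕ) < 2 * r.2.1) ∧
        2 * r.2.2.1 < (j : ℕ) ∧ (j : ℕ) < 2 * r.2.2.2) ∨
      ∃ k : Fin 14,
        (2 * min (corner k).1 (corner (k + 1)).1 ≤ (i : ℕ) ∧
          (i : ℕ) ≤ 2 * max (corner k).1 (corner (k + 1)).1) ∧
        2 * min (corner k).2 (corner (k + 1)).2 ≤ (j : ℕ) ∧
          (j : ℕ) ≤ 2 * max (corner k).2 (corner (k + 1)).2 := by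
    decide +kernel
  have hvert : ∀ k : Fin 14, (vertex (k + 1)).1 = (vertex k).1 ∨
      (vertex (k + 1)).2 = (vertex k).2 := by decide
  have hbound : ∀ r ∈ rooms, (0 ≤ r.1 ∧ r.2.1 ≤ 13) ∧ 0 ≤ r.2.2.1 ∧ r.2.2.2 ≤ 18 := by decide
  obtain ⟨⟨h₁, h₂⟩, h₃, h₄⟩ := hx
  obtain ⟨⟨b₁, b₂⟩, b₃, b₄⟩ := hbound r hr
  rw [← le_gridIndex] at h₁ h₃
  rw [← gridIndex_le] at h₂ h₄
  obtain ⟨i, hi⟩ := Int.eq_ofNat_of_zero_le (show 0 ≤ gridIndex x.1 by omega)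
  obtain ⟨j, hj⟩ := Int.eq_ofNat_of_zero_le (show 0 ≤ gridIndex x.2 by omega)
  have := key ⟨i, by omega⟩ ⟨j, by omega⟩ ⟨r, hr, by
    simp only [← hi, ← hj]; exact ⟨⟨h₁, h₂⟩, h₃, h₄⟩⟩
  simp only [← hi, ← hj] at this
  rcases this with ⟨r', hr', ⟨h₁, h₂⟩, h₃, h₄⟩ | ⟨k, ⟨h₁, h₂⟩, h₃, h₄⟩
  · rw [lt_gridIndex] at h₁ h₃
    rw [gridIndex_lt] at h₂ h₄
    exact .inl ⟨r', hr', ⟨h₁, h₂⟩, h₃, h₄⟩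
  · rw [le_gridIndex] at h₁ h₃
    rw [gridIndex_le] at h₂ h₄
    refine .inr (mem_tower_boundary.2 ⟨k, mem_segment_of_box (hvert k) ?_ ?_ ?_ ?_⟩)
    · rw [vertex, vertex, ← mul_min_of_nonneg _ _ (by norm_num)]; exact_mod_cast h₁
    · rw [vertex, vertex, ← mul_max_of_nonneg _ _ (by norm_num)]; exact_mod_cast h₂
    · rw [vertex, vertex, ← mul_min_of_nonneg _ _ (by norm_num)]; exact_mod_cast h₃
    · rw [vertex, vertex, ← mul_max_of_nonneg _ _ (by norm_num)]; exact_mod_cast h₄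

lemma openRoom_subset_closedRoom (r : ℤ × ℤ × ℤ × ℤ) : openRoom r ⊆ closedRoom r :=
  Set.prod_mono Set.Ioo_subset_Icc_self Set.Ioo_subset_Icc_self

/-- The union of the open rooms is open and closed in the complement of the boundary. -/
lemma mem_tower_interior {x : Plane} (hx : x ∉ tower.boundary ℝ)
    (hx' : ∃ r ∈ rooms, x ∈ openRoom r) : x ∈ polygonInterior tower := by
  refine ⟨hx, ?_⟩
  set U : Set Plane := ⋃ r ∈ rooms, openRoom r with hU
  set R : Set Plane := ⋃ r ∈ rooms, closedRoom r with hR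
  have hfin : {r | r ∈ rooms}.Finite := rooms.finite_toSet
  have hUo : IsOpen U := isOpen_biUnion fun r _ => isOpen_Ioo.prod isOpen_Ioo
  have hRc : IsClosed R := hfin.isClosed_biUnion fun r _ => isClosed_Icc.prod isClosed_Icc
  have hUR : U ⊆ R := Set.iUnion₂_mono fun r _ => openRoom_subset_closedRoom r
  have hxU : x ∈ U := by simpa [hU] using hx'
  -- Off the boundary, `U` and the complement of `R` are disjoint open sets covering everything, so
  -- a component meeting `U` stays in it.
  have hsub : connectedComponentIn (tower.boundary ℝ)ᶜ x ⊆ U := by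
    refine isPreconnected_connectedComponentIn.subset_left_of_subset_union hUo hRc.isOpen_compl
      (Set.disjoint_compl_right_iff_subset.2 hUR) ?_ ⟨x, mem_connectedComponentIn hx, hxU⟩
    intro y hy
    have hyb := connectedComponentIn_subset _ _ hy
    by_cases hyR : y ∈ R
    · left
      obtain ⟨r, hr, hyr⟩ := Set.mem_iUnion₂.1 hyR
      rcases closedRoom_subset hr hyr with h | h
      · simpa [hU] using h
      · exact absurd h hyb
    · exact .inr hyR
  refine Bornology.IsBounded.subset ?_ (hsub.trans hUR)
  exact (Bornology.isBounded_biUnion hfin).2 fun r _ =>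
    (Metric.isBounded_Icc _ _).prod (Metric.isBounded_Icc _ _)

/-- The open segment `p q` avoids the boundary, and its midpoint lies in a room. -/
def clear (p q : ℤ × ℤ) : Bool :=
  (rooms.any fun r => decide (24 * r.1 < p.1 + q.1) && decide (p.1 + q.1 < 24 * r.2.1) &&
    decide (24 * r.2.2.1 < p.2 + q.2) && decide (p.2 + q.2 < 24 * r.2.2.2)) &&
  (List.finRange 14).all fun i => separated p q (vertex i) (vertex (i + 1))

/-- An open segment avoiding the boundary lies in a single component of the complement, so its
midpoint decides for all of it. -/
lemma openSegment_subset_tower_interior {p q : ℤ × ℤ} (h : clear p q = true) :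
    openSegment ℝ (latticePoint p) (latticePoint q) ⊆ polygonInterior tower := by
  simp only [clear, Bool.and_eq_true, List.any_eq_true, List.all_eq_true, decide_eq_true_eq] at h
  obtain ⟨⟨r, hr, ⟨⟨h₁, h₂⟩, h₃⟩, h₄⟩, hs⟩ := h
  have hb : openSegment ℝ (latticePoint p) (latticePoint q) ⊆ (tower.boundary ℝ)ᶜ := by
    intro z hz hz'
    obtain ⟨i, hi⟩ := mem_tower_boundary.1 hz'
    exact Set.disjoint_left.1 (disjoint_of_separated (hs i (List.mem_finRange i))) hz hi
  set m : Plane := (1 / 2 : ℝ) • latticePoint p + (1 / 2 : ℝ) • latticePoint q with hm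
  have hmem : m ∈ openSegment ℝ (latticePoint p) (latticePoint q) :=
    ⟨1 / 2, 1 / 2, by norm_num, by norm_num, by norm_num, rfl⟩
  have hint : m ∈ polygonInterior tower := by
    refine mem_tower_interior (hb hmem) ⟨r, hr, ?_⟩
    have h₁' : (24 * r.1 : ℝ) < p.1 + q.1 := mod_cast h₁
    have h₂' : (p.1 + q.1 : ℝ) < 24 * r.2.1 := mod_cast h₂
    have h₃' : (24 * r.2.2.1 : ℝ) < p.2 + q.2 := mod_cast h₃
    have h₄' : (p.2 + q.2 : ℝ) < 24 * r.2.2.2 := mod_cast h₄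
    refine ⟨⟨?_, ?_⟩, ?_, ?_⟩ <;>
      simp only [hm, Prod.fst_add, Prod.snd_add, Prod.smul_fst, Prod.smul_snd, smul_eq_mul,
        latticePoint_fst, latticePoint_snd] <;> linarith
  intro z hz
  refine ⟨hb hz, ?_⟩
  have : z ∈ connectedComponentIn (tower.boundary ℝ)ᶜ m :=
    (convex_openSegment _ _).isPreconnected.subset_connectedComponentIn hmem hb hz
  rw [← connectedComponentIn_eq this]
  exact hint.2

lemma pointsSee_of_clear {p q : ℤ × ℤ} (h : clear p q = true) :
    PointsSee tower (latticePoint p) (latticePoint q) :=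
  (segmentInterior_subset_openSegment _ _).trans (openSegment_subset_tower_interior h)

lemma mem_tower_interior_of_clear {p : ℤ × ℤ} (h : clear p p = true) :
    latticePoint p ∈ polygonInterior tower :=
  openSegment_subset_tower_interior h (by simp)

/-- Going from the midpoint of `p q` in the direction `u`, one never meets the boundary. -/
def escapes (p q u : ℤ × ℤ) : Bool :=
  (List.finRange 14).all fun i =>
    let c := vertex i
    let d := vertex (i + 1)
    decide (0 ≤ u.1 ∧ 2 * c.1 < p.1 + q.1 ∧ 2 * d.1 < p.1 + q.1) ||
    decide (u.1 ≤ 0 ∧ p.1 + q.1 < 2 * c.1 ∧ p.1 + q.1 < 2 * d.1) ||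
    decide (0 ≤ u.2 ∧ 2 * c.2 < p.2 + q.2 ∧ 2 * d.2 < p.2 + q.2) ||
    decide (u.2 ≤ 0 ∧ p.2 + q.2 < 2 * c.2 ∧ p.2 + q.2 < 2 * d.2)

lemma not_isBounded_ray (m : Plane) {u : Plane} (hu : u ≠ 0) :
    ¬ Bornology.IsBounded ((fun s : ℝ => m + s • u) '' Set.Ici 0) := by
  intro h
  obtain ⟨C, hC⟩ := h.exists_norm_le
  have hu' : 0 < ‖u‖ := norm_pos_iff.2 hu
  have hC0 : 0 ≤ C := (norm_nonneg _).trans (hC _ ⟨0, Set.self_mem_Ici, rfl⟩)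
  have hs : 0 ≤ (C + ‖m‖ + 1) / ‖u‖ := by positivity
  have h₁ := hC _ ⟨_, hs, rfl⟩
  have h₂ : ‖((C + ‖m‖ + 1) / ‖u‖) • u‖ = C + ‖m‖ + 1 := by
    rw [norm_smul, Real.norm_of_nonneg hs, div_mul_cancel₀ _ hu'.ne']
  have h₃ := norm_sub_le (m + ((C + ‖m‖ + 1) / ‖u‖) • u) m
  rw [add_sub_cancel_left, h₂] at h₃
  linarith

/-- The ray is connected, unbounded and off the boundary, so the component of its starting point is
unbounded. -/
lemma notMem_tower_interior_of_escapes {p q u : ℤ × ℤ} (hu : u ≠ 0) (h : escapes p q u = true) :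
    (1 / 2 : ℝ) • latticePoint p + (1 / 2 : ℝ) • latticePoint q ∉ polygonInterior tower := by
  set m : Plane := (1 / 2 : ℝ) • latticePoint p + (1 / 2 : ℝ) • latticePoint q with hm
  have hu' : latticePoint u ≠ 0 := by
    intro h0
    apply hu
    simpa [latticePoint, Prod.ext_iff] using h0
  rintro ⟨-, hb⟩
  refine not_isBounded_ray m hu' (hb.subset ?_)
  have hconn : IsPreconnected ((fun s : ℝ => m + s • latticePoint u) '' Set.Ici 0) :=
    isPreconnected_Ici.image _ (by fun_prop)
  refine hconn.subset_connectedComponentIn ⟨0, Set.self_mem_Ici, by simp⟩ ?_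
  rintro _ ⟨s, hs, rfl⟩ hz
  obtain ⟨i, hi⟩ := mem_tower_boundary.1 hz
  simp only [escapes, List.all_eq_true] at h
  replace h := h i (List.mem_finRange i)
  obtain ⟨a, b, ha, hb, hab, he⟩ := hi
  have hx := congrArg Prod.fst he
  have hy := congrArg Prod.snd he
  simp only [hm, Prod.fst_add, Prod.snd_add, Prod.smul_fst, Prod.smul_snd, smul_eq_mul,
    latticePoint_fst, latticePoint_snd] at hx hy
  have hs : 0 ≤ s := hs
  have key : ∀ {e v c d : ℝ}, 0 ≤ v → 2 * c < e → 2 * d < e →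
      a * c + b * d < 1 / 2 * e + s * v := by
    intro e v c d hv hc hd
    have h₁ := mul_nonneg hs hv
    obtain rfl : b = 1 - a := by linarith
    rcases ha.eq_or_lt with rfl | ha'
    · linarith
    · nlinarith [mul_pos ha' (sub_pos.2 hc), mul_nonneg hb (sub_pos.2 hd).le]
  simp only [Bool.or_eq_true, decide_eq_true_eq] at h
  rcases h with ((⟨h₁, h₂, h₃⟩ | ⟨h₁, h₂, h₃⟩) | ⟨h₁, h₂, h₃⟩) | ⟨h₁, h₂, h₃⟩
  · have := key (e := p.1 + q.1) (v := u.1) (c := (vertex i).1) (d := (vertex (i + 1)).1)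
      (by exact_mod_cast h₁) (by exact_mod_cast h₂) (by exact_mod_cast h₃)
    linarith
  · have := key (e := -(p.1 + q.1)) (v := -u.1) (c := -(vertex i).1) (d := -(vertex (i + 1)).1)
      (by exact_mod_cast neg_nonneg.2 h₁) (by rw [mul_neg, neg_lt_neg_iff]; exact_mod_cast h₂)
      (by rw [mul_neg, neg_lt_neg_iff]; exact_mod_cast h₃)
    linarith
  · have := key (e := p.2 + q.2) (v := u.2) (c := (vertex i).2) (d := (vertex (i + 1)).2)
      (by exact_mod_cast h₁) (by exact_mod_cast h₂) (by exact_mod_cast h₃)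
    linarith
  · have := key (e := -(p.2 + q.2)) (v := -u.2) (c := -(vertex i).2) (d := -(vertex (i + 1)).2)
      (by exact_mod_cast neg_nonneg.2 h₁) (by rw [mul_neg, neg_lt_neg_iff]; exact_mod_cast h₂)
      (by rw [mul_neg, neg_lt_neg_iff]; exact_mod_cast h₃)
    linarith

/-! ### Guards -/

/-- The segment between two vertices, given by their indices. -/
def chord (g : Fin 14 × Fin 14) : Set Plane :=
  segment ℝ (latticePoint (vertex g.1)) (latticePoint (vertex g.2))

/-- The diagonals of the polygon. -/
def diagonals : List (Fin 14 × Fin 14) :=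
  [(0, 2), (0, 7), (0, 8), (0, 10), (0, 12), (1, 13), (2, 6), (2, 7), (2, 8), (2, 10), (2, 12),
    (2, 13), (3, 5), (3, 6), (3, 7), (3, 12), (3, 13), (4, 6), (5, 7), (5, 12), (7, 11), (7, 12),
    (8, 10), (8, 11), (8, 12), (9, 11), (10, 12)]

/-- All mobile guards of the polygon. -/
def guards : List (Fin 14 × Fin 14) :=
  (List.finRange 14).map (fun i => (i, i + 1)) ++ diagonals

/-- Some edge of the polygon crosses all segments from `w` to the part of the segment `a b`
between the parameters `k₀ / 12` and `k₁ / 12`. -/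
def blocked (w a b : ℤ × ℤ) (k₀ k₁ : ℤ) : Bool :=
  (List.finRange 14).any fun i =>
    (blocksAt w a b (vertex i) (vertex (i + 1)) k₀ &&
      blocksAt w a b (vertex i) (vertex (i + 1)) k₁) ||
    (blocksAt w a b (vertex (i + 1)) (vertex i) k₀ &&
      blocksAt w a b (vertex (i + 1)) (vertex i) k₁)

lemma exists_mem_boundary_of_blocked {w a b : ℤ × ℤ} {k₀ k₁ : ℤ}
    (h : blocked w a b k₀ k₁ = true) {t : ℝ} (ht₀ : k₀ ≤ 12 * t) (ht₁ : 12 * t ≤ k₁) :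
    ∃ z ∈ segmentInterior (latticePoint w) ((1 - t) • latticePoint a + t • latticePoint b),
      z ∈ tower.boundary ℝ := by
  simp only [blocked, List.any_eq_true, Bool.or_eq_true, Bool.and_eq_true] at h
  obtain ⟨i, -, ⟨h₀, h₁⟩ | ⟨h₀, h₁⟩⟩ := h
  · obtain ⟨z, hz, hz'⟩ := exists_mem_of_blocksAt h₀ h₁ ht₀ ht₁
    exact ⟨z, hz, mem_tower_boundary.2 ⟨i, hz'⟩⟩
  · obtain ⟨z, hz, hz'⟩ := exists_mem_of_blocksAt h₀ h₁ ht₀ ht₁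
    rw [segment_symm] at hz'
    exact ⟨z, hz, mem_tower_boundary.2 ⟨i, hz'⟩⟩

/-- The two vertices are the endpoints of a segment that meets the boundary or has its midpoint
outside of the polygon. -/
def notDiagonal (g : Fin 14 × Fin 14) : Bool :=
  blocked (vertex g.1) (vertex g.2) (vertex g.2) 0 12 ||
    [(1, 0), (0, 1), (0, -1)].any fun u => escapes (vertex g.1) (vertex g.2) u

lemma eq_of_half_add_half_eq {p q : Plane} (h : (1 / 2 : ℝ) • p + (1 / 2 : ℝ) • q = p) :
    p = q := by
  have hx := congrArg Prod.fst h
  have hy := congrArg Prod.snd h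
  simp only [Prod.fst_add, Prod.snd_add, Prod.smul_fst, Prod.smul_snd, smul_eq_mul] at hx hy
  ext <;> linarith

lemma not_subset_interior_of_notDiagonal {g : Fin 14 × Fin 14} (h : notDiagonal g = true)
    (hne : vertex g.1 ≠ vertex g.2) :
    ¬ segmentInterior (tower g.1) (tower g.2) ⊆ polygonInterior tower := by
  intro hsub
  rw [notDiagonal, Bool.or_eq_true, List.any_eq_true] at h
  rcases h with h | ⟨u, hu, h⟩
  -- In `notDiagonal` the target segment degenerates to one vertex, so any parameter in the interval
  -- would do.
  · obtain ⟨z, hz, hz'⟩ := exists_mem_boundary_of_blocked h (t := 0) (by simp) (by simp)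
    simp only [sub_zero, one_smul, zero_smul, add_zero] at hz
    exact (hsub hz).1 hz'
  · refine notMem_tower_interior_of_escapes ?_ h (hsub ⟨?_, ?_⟩)
    · exact (by decide : ∀ u ∈ [((1 : ℤ), (0 : ℤ)), (0, 1), (0, -1)], u ≠ 0) u hu
    · exact ⟨1 / 2, 1 / 2, by norm_num, by norm_num, by norm_num, rfl⟩
    · have hne' : latticePoint (vertex g.1) ≠ latticePoint (vertex g.2) := by
        intro h0
        apply hne
        simpa [latticePoint, Prod.ext_iff] using h0
      rintro (h0 | h0)
      · exact hne' (eq_of_half_add_half_eq h0)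
      · rw [Set.mem_singleton_iff, add_comm] at h0
        exact hne' (eq_of_half_add_half_eq h0).symm

/-- Only completeness of `diagonals` matters: all other pairs of non-consecutive vertices are
excluded, while the listed ones need not be verified. -/
lemma exists_guard_of_isClosedMobileGuard {g : Set Plane} (h : IsClosedMobileGuard tower g) :
    ∃ e ∈ guards, g = chord e := by
  have key : ∀ i j : Fin 14, i < j → j ≠ i + 1 → i ≠ j + 1 →
      (i, j) ∈ diagonals ∨ notDiagonal (i, j) = true ∧ vertex i ≠ vertex j := by
    decide +kernel
  have hdiag : ∀ {e}, e ∈ diagonals → e ∈ guards := fun {e} he => by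
    rw [guards]; exact List.mem_append_right _ he
  rcases h with ⟨i, rfl⟩ | ⟨i, j, hij, hj, hi, hsub, rfl⟩
  · refine ⟨(i, i + 1), ?_, tower_edgeSet i⟩
    rw [guards, List.mem_append, List.mem_map]
    exact .inl ⟨i, List.mem_finRange i, rfl⟩
  · rw [finRotate_apply] at hi hj
    rcases lt_or_gt_of_ne hij with hlt | hlt
    · rcases key i j hlt hj hi with h | ⟨h, hne⟩
      · exact ⟨(i, j), hdiag h, rfl⟩
      · exact (not_subset_interior_of_notDiagonal (g := (i, j)) h hne hsub).elim
    · rcases key j i hlt hi hj with h | ⟨h, hne⟩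
      · exact ⟨(j, i), hdiag h, segment_symm _ _ _⟩
      · rw [segmentInterior_symm] at hsub
        exact (not_subset_interior_of_notDiagonal (g := (j, i)) h hne hsub).elim

/-- The guard is not visible from `w`, as seen by cutting it into at most two pieces. -/
def invisible (w : ℤ × ℤ) (g : Fin 14 × Fin 14) : Bool :=
  [12, 5, 6, 7, 8, 11].any fun k =>
    blocked w (vertex g.1) (vertex g.2) 0 k && blocked w (vertex g.1) (vertex g.2) k 12

/-- The pieces on the two sides of the cut may be hidden by different edges. The cut `k = 12`
amounts to no cut. -/
lemma not_guardSees_of_invisible {w : ℤ × ℤ} {g : Fin 14 × Fin 14} (h : invisible w g = true) :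
    ¬ GuardSees tower (chord g) (latticePoint w) := by
  rintro ⟨p, hp, hsee⟩
  rw [chord, segment_eq_image] at hp
  obtain ⟨t, ⟨ht₀, ht₁⟩, rfl⟩ := hp
  simp only [invisible, List.any_eq_true, Bool.and_eq_true] at h
  obtain ⟨k, -, h₁, h₂⟩ := h
  rcases le_total (12 * t) k with hk | hk
  · obtain ⟨z, hz, hz'⟩ := exists_mem_boundary_of_blocked h₁ (by push_cast; linarith) hk
    exact (hsee hz).1 hz'
  · obtain ⟨z, hz, hz'⟩ := exists_mem_boundary_of_blocked h₂ hk (by push_cast; linarith)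
    exact (hsee hz).1 hz'

/-- The point that divides a guard in the ratio `k : 3 - k`. -/
def thirdPoint (g : Fin 14 × Fin 14) (k : ℤ) : ℤ × ℤ :=
  (4 * ((3 - k) * (corner g.1).1 + k * (corner g.2).1),
    4 * ((3 - k) * (corner g.1).2 + k * (corner g.2).2))

lemma thirdPoint_mem_chord (g : Fin 14 × Fin 14) {k : ℤ} (h₀ : 0 ≤ k) (h₁ : k ≤ 3) :
    latticePoint (thirdPoint g k) ∈ chord g := by
  have h₀' : (0 : ℝ) ≤ k := mod_cast h₀
  have h₁' : (k : ℝ) ≤ 3 := mod_cast h₁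
  rw [chord, segment_eq_image]
  refine ⟨k / 3, ⟨by positivity, by linarith⟩, ?_⟩
  ext <;> simp only [thirdPoint, vertex, Prod.fst_add, Prod.snd_add, Prod.smul_fst, Prod.smul_snd,
    smul_eq_mul, latticePoint_fst, latticePoint_snd] <;> push_cast <;> ring

/-- Two of the points dividing the guards into thirds coincide or see each other. -/
def meet (g h : Fin 14 × Fin 14) : Bool :=
  [0, 3, 1, 2].any fun k => [0, 3, 1, 2].any fun l =>
    decide (thirdPoint g k = thirdPoint h l) || clear (thirdPoint g k) (thirdPoint h l)

lemma guardsSeeEachOther_of_meet {g h : Fin 14 × Fin 14} (hm : meet g h = true) :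
    GuardsSeeEachOther tower (chord g) (chord h) := by
  have hrange : ∀ k ∈ [(0 : ℤ), 3, 1, 2], 0 ≤ k ∧ k ≤ 3 := by decide
  simp only [meet, List.any_eq_true, Bool.or_eq_true, decide_eq_true_eq] at hm
  obtain ⟨k, hk, l, hl, hkl⟩ := hm
  refine ⟨_, thirdPoint_mem_chord g (hrange k hk).1 (hrange k hk).2,
    _, thirdPoint_mem_chord h (hrange l hl).1 (hrange l hl).2, ?_⟩
  rcases hkl with h | h
  -- For coinciding points the segment without endpoints is empty, so guards that touch see each
  -- other.
  · rw [h]; simp [PointsSee, segmentInterior]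
  · exact pointsSee_of_clear h

/-! ### Three witnesses and the contradiction. -/

/-- The guards that may see the point `(9, 51)` in the dent on the left. -/
def dentGuards : List (Fin 14 × Fin 14) :=
  [(0, 1), (1, 2), (2, 3), (12, 13), (13, 0), (0, 2), (0, 7), (0, 8), (0, 10), (0, 12), (1, 13),
    (2, 6), (2, 7), (2, 8), (2, 10), (2, 12), (2, 13), (3, 13)]

/-- The guards that may see the point `(75, 135)` in the upper room. -/
def upperGuards : List (Fin 14 × Fin 14) :=
  [(7, 8), (8, 9), (9, 10), (10, 11), (11, 12), (0, 8), (0, 10), (2, 8), (2, 10), (7, 11), (8, 10),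
    (8, 11), (8, 12), (9, 11), (10, 12)]

/-- The guards that may see the point `(96, 6)` in the leg. -/
def legGuards : List (Fin 14 × Fin 14) :=
  [(2, 3), (3, 4), (4, 5), (5, 6), (6, 7), (2, 6), (3, 5), (3, 6), (3, 7), (3, 12), (3, 13), (4, 6),
    (5, 7), (5, 12)]

lemma exists_guard_sees {S : Set (Set Plane)} (hS : IsClosedMobileGuardSet tower S) {w : ℤ × ℤ}
    (hw : clear w w = true) {L : List (Fin 14 × Fin 14)}
    (hL : ∀ e ∈ guards, e ∈ L ∨ invisible w e = true) :
    ∃ e ∈ L, chord e ∈ S ∧ GuardSees tower (chord e) (latticePoint w) := by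
  obtain ⟨g, hg, hsee⟩ := hS.2 _ (mem_tower_interior_of_clear hw)
  obtain ⟨e, he, rfl⟩ := exists_guard_of_isClosedMobileGuard (hS.1 g hg)
  rcases hL e he with h | h
  · exact ⟨e, h, hg, hsee⟩
  · exact absurd hsee (not_guardSees_of_invisible h)

/-- Hiddenness only constrains distinct guards; here `w` tells the two apart, being seen by one and
not by the other. -/
lemma not_isHidden_of_meet {S : Set (Set Plane)} {w : ℤ × ℤ} {b a : Fin 14 × Fin 14}
    (hb : chord b ∈ S) (ha : chord a ∈ S) (hbw : invisible w b = true)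
    (haw : GuardSees tower (chord a) (latticePoint w)) (hm : meet b a = true) :
    ¬ IsHidden tower S := by
  intro hS
  refine hS hb ha ?_ (guardsSeeEachOther_of_meet hm)
  intro h
  rw [← h] at haw
  exact not_guardSees_of_invisible hbw haw

lemma tower_not_admits : ¬ AdmitsHiddenClosedMobileGuardSet tower := by
  rintro ⟨S, hS, hhid⟩
  -- This witness lies so low beside the neck that its sight line past corner 8 meets the neck's
  -- left wall above the wide room, so `b` must reach into the neck or the upper room. The dent and
  -- leg witnesses, in turn, see nothing through the neck.
  obtain ⟨b, hb, hbS, -⟩ := exists_guard_sees hS (w := (75, 135)) (L := upperGuards)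
    (by decide +kernel) (by decide +kernel)
  obtain ⟨a, ha, haS, haw⟩ := exists_guard_sees hS (w := (9, 51)) (L := dentGuards)
    (by decide +kernel) (by decide +kernel)
  obtain ⟨c, hc, hcS, hcw⟩ := exists_guard_sees hS (w := (96, 6)) (L := legGuards)
    (by decide +kernel) (by decide +kernel)
  -- Both alternatives occur: guards ending at corner 0 or 2 see the dent witness and need the
  -- second, while the right wall `(9, 10)` of the upper room has no view into the leg and needs the
  -- first.
  have key : ∀ b ∈ upperGuards,
      (invisible (9, 51) b = true ∧ ∀ a ∈ dentGuards, meet b a = true) ∨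
      (invisible (96, 6) b = true ∧ ∀ c ∈ legGuards, meet b c = true) := by
    decide +kernel
  rcases key b hb with ⟨h, hm⟩ | ⟨h, hm⟩
  · exact not_isHidden_of_meet hbS haS h haw (hm a ha) hhid
  · exact not_isHidden_of_meet hbS hcS h hcw (hm c hc) hhid

end ArtGallery

theorem mainTheorem9 :
    ∃ (n : ℕ) (_ : NeZero n) (P : Polygon ArtGallery.Plane n),
      ArtGallery.IsSimplePolygon P ∧ ArtGallery.IsOrthogonal P ∧
        ¬ ArtGallery.AdmitsHiddenClosedMobileGuardSet P :=
  ⟨14, inferInstance, ArtGallery.tower, ArtGallery.tower_simple, ArtGallery.tower_orthogonal,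
    ArtGallery.tower_not_admits⟩
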